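/- Let $A,B,X$ be complex $n\times n$ matrices with $A$ and $B$ positive semidefinite, and let $|||\cdot|||$ be a unitarily invariant norm on the complex $n\times n$ matrices, that is, a norm with $|||UXV|||=|||X|||$ for all matrices $X$ and all unitary $U,V$. For $v\ge 0$ let $A^v$ and $B^v$ denote the powers in the sense of the functional calculus, with the convention $A^0=B^0=I$. Then for every real $s$ with $0\le s<\frac12$ the matrix-valued function $v\mapsto A^vXB^{1-v}$ is (entrywise) integrable on $[s,1-s]$, and $$\left|\left|\left|\int_s^{1-s}A^vXB^{1-v}\,dv\right|\right|\right|\le\frac{1-2s}{2}\,\bigl|\bigl|\bigl|A^{1-s}XB^s+A^sXB^{1-s}\bigr|\bigr|\bigr|.$$ In particular, for $s=0$ this is the logarithmic–arithmetic mean inequality of Hiai and Kosaki, $$\left|\left|\left|\int_0^1A^vXB^{1-v}\,dv\right|\right|\right|\le\frac12\,|||AX+XB|||.$$ -/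

import Mathlib

open scoped MatrixOrder ComplexOrder

/-- A unitarily invariant norm on the complex square matrices indexed by `n`: a seminorm over `ℂ`
that separates points and satisfies `|||U * X * V||| = |||X|||` for all unitary `U`, `V`. -/
structure IsUnitarilyInvariantNorm {n : Type*} [Fintype n] [DecidableEq n]
    (N : Seminorm ℂ (Matrix n n ℂ)) : Prop where
  eq_zero_of_map_eq_zero : ∀ X : Matrix n n ℂ, N X = 0 → X = 0
  map_unitary_mul_mul : ∀ U ∈ Matrix.unitaryGroup n ℂ, ∀ V ∈ Matrix.unitaryGroup n ℂ,
    ∀ X : Matrix n n ℂ, N (U * X * V) = N X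

/-- The integral `∫ v in a..b, F v` of a matrix-valued function, computed entry by entry. -/
noncomputable def matrixIntegral {n : Type*} (F : ℝ → Matrix n n ℂ) (a b : ℝ) : Matrix n n ℂ :=
  Matrix.of fun i j => ∫ v in a..b, F v i j

/-- Integrability of a matrix-valued function on the interval from `a` to `b`: every entry is
integrable there. -/
def MatrixIntegrable {n : Type*} (F : ℝ → Matrix n n ℂ) (a b : ℝ) : Prop :=
  ∀ i j, IntervalIntegrable (fun v => F v i j) MeasureTheory.volume a b

/-!
The inequality is a statement about Schur multipliers. In eigenbases of `A` and `B`, with eigenvalues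
`a i` and `b j`, the matrices on the two sides are entrywise multiples of one matrix, and for
`a i, b j > 0` the two entries differ by the factor `c * tanh t / t`, where `c = (1 - 2 s) / 2` and
`t = c * (log (a i) - log (b j))` (`integral_rpow_mul_rpow`). If `a i` or `b j` vanishes, the left
entry is zero. It remains to see that entrywise multiplication by `tanh t / t`, for
`t = x i - y j`, does not increase a unitarily invariant norm.

The functions `m` for which multiplication by `m (x i - y j)` is contractive are closed under
products, convex combinations and pointwise limits. Among them is `1 / (1 + i t)`: multiplication by
`1 + i t` is the identity plus the generator of the isometry group given by `exp (i h t)`, which acts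
by diagonal unitaries, so it does not decrease the norm
(`IsUnitarilyInvariantNorm.le_map_hadamard_one_add`). Hence `1 / (1 + t² / α²)` is contractive as a
product of two such functions, and `(1 + t² / β²) / (1 + t² / α²)` for `α ≤ β` as a convex
combination of it with `1`. Finally Euler's product for the sine gives
`tanh t / t = ∏ (1 + t² / (k π)²) / (1 + t² / ((k - 1 / 2) π)²)` over `k ≥ 1`
(`tendsto_prod_tanhc`), a limit of products of such quotients.
-/

/-! ### The hyperbolic tangent as an infinite product -/

/-- The partial product `∏_{k < m} (1 + x² / ((k + 1) π)²)` of Euler's product for `sinh x / x`. -/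
noncomputable def sinhProd (m : ℕ) (x : ℝ) : ℝ :=
  ∏ k ∈ Finset.range m, (1 + x ^ 2 / ((k + 1) * Real.pi) ^ 2)

/-- The function `tanh x / x`, extended by its limit `1` at `x = 0`. -/
noncomputable def tanhc (x : ℝ) : ℝ := if x = 0 then 1 else Real.tanh x / x

lemma tendsto_mul_sinhProd (x : ℝ) :
    Filter.Tendsto (fun m => x * sinhProd m x) Filter.atTop (nhds (Real.sinh x)) := by
  have h := Complex.tendsto_euler_sin_prod (x * Complex.I / Real.pi)
  have hpi : (Real.pi : ℂ) ≠ 0 := by exact_mod_cast Real.pi_ne_zero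
  have e : (Real.pi : ℂ) * (x * Complex.I / Real.pi) = x * Complex.I := by field_simp
  rw [e, Complex.sin_mul_I] at h
  have h2 := (h.mul_const (-Complex.I))
  have e2 : Complex.sinh x * Complex.I * -Complex.I = ((Real.sinh x : ℝ) : ℂ) := by
    rw [mul_assoc, mul_neg, Complex.I_mul_I, Complex.ofReal_sinh]; simp
  rw [e2] at h2
  refine (Complex.continuous_re.tendsto _).comp h2 |>.congr fun m => ?_
  have : (x : ℂ) * Complex.I *
      (∏ j ∈ Finset.range m, (1 - (x * Complex.I / Real.pi) ^ 2 / ((j : ℂ) + 1) ^ 2)) *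
      -Complex.I = ((x * sinhProd m x : ℝ) : ℂ) := by
    rw [sinhProd]
    push_cast
    rw [mul_right_comm, mul_assoc (x : ℂ), mul_neg, Complex.I_mul_I, neg_neg, mul_one]
    congr 1
    refine Finset.prod_congr rfl fun j _ => ?_
    rw [div_pow, mul_pow, Complex.I_sq, mul_pow, div_div]
    ring
  simp only [Function.comp_apply]
  rw [this, Complex.ofReal_re]

lemma sinhProd_pos (m : ℕ) (x : ℝ) : 0 < sinhProd m x :=
  Finset.prod_pos fun k _ => by positivity

/-- Splitting the factors of `sinh (2 x) / (2 x)` by the parity of the index: the factors of even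
rank are those of `sinh x / x`. -/
lemma sinhProd_two_mul (m : ℕ) (x : ℝ) :
    sinhProd (2 * m) (2 * x) = sinhProd m x *
      ∏ k ∈ Finset.range m, (1 + (2 * x) ^ 2 / ((2 * k + 1) * Real.pi) ^ 2) := by
  induction m with
  | zero => simp [sinhProd]
  | succ m ih =>
    unfold sinhProd at ih ⊢
    rw [show 2 * (m + 1) = 2 * m + 1 + 1 by ring, Finset.prod_range_succ, Finset.prod_range_succ,
      ih, Finset.prod_range_succ _ m, Finset.prod_range_succ _ m]
    have : 1 + (2 * x) ^ 2 / ((((2 * m + 1 : ℕ) : ℝ) + 1) * Real.pi) ^ 2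
        = 1 + x ^ 2 / ((m + 1) * Real.pi) ^ 2 := by
      have := Real.pi_ne_zero
      push_cast
      field_simp
      ring
    rw [this]
    push_cast
    ring

lemma tendsto_prod_tanhc (x : ℝ) :
    Filter.Tendsto (fun m => ∏ k ∈ Finset.range m, ((1 + x ^ 2 / ((k + 1) * Real.pi) ^ 2) /
      (1 + (2 * x) ^ 2 / ((2 * k + 1) * Real.pi) ^ 2))) Filter.atTop (nhds (tanhc x)) := by
  by_cases hx : x = 0
  · simp [hx, tanhc]
  have hs : Real.sinh x ≠ 0 := by simpa using hx
  have hc : Real.cosh x ≠ 0 := (Real.cosh_pos x).ne'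
  have h1 := (tendsto_mul_sinhProd x).div_const x
  have h2 := ((tendsto_mul_sinhProd (2 * x)).comp
    (Filter.tendsto_id.const_mul_atTop' (r := 2) two_pos)).div_const (2 * x)
  -- `tanh x / x = (sinh x / x)² / (sinh (2 x) / (2 x))`
  have h3 := (h1.pow 2).div h2 (by rw [Real.sinh_two_mul]; positivity)
  have e : (Real.sinh x / x) ^ 2 / (Real.sinh (2 * x) / (2 * x)) = tanhc x := by
    rw [tanhc, if_neg hx, Real.sinh_two_mul, Real.tanh_eq_sinh_div_cosh]
    field_simp
  rw [e] at h3
  refine h3.congr fun m => ?_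
  have p1 := sinhProd_pos m x
  simp only [Pi.div_apply, Function.comp_apply, id]
  rw [Finset.prod_div_distrib, mul_div_cancel_left₀ _ hx, mul_div_cancel_left₀ _ (by positivity),
    sinhProd_two_mul, sq, mul_div_mul_left _ _ p1.ne', sinhProd]

/-! ### The scalar integral -/

/-- The factor relating `∫ a ^ v * b ^ (1 - v)` over `[s, 1 - s]` to
`a ^ (1 - s) * b ^ s + a ^ s * b ^ (1 - s)`; set to `0` if `a` or `b` vanishes,
as the integral then does. -/
noncomputable def heinzFactor (c a b : ℝ) : ℝ :=
  if 0 < a ∧ 0 < b then c * tanhc (c * Real.log a - c * Real.log b) else 0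

lemma rpow_mul_rpow_eq_exp {a b : ℝ} (ha : 0 < a) (hb : 0 < b) (v : ℝ) :
    a ^ v * b ^ (1 - v) = b * Real.exp ((Real.log a - Real.log b) * v) := by
  rw [Real.rpow_def_of_pos ha, Real.rpow_def_of_pos hb, ← Real.exp_add]
  conv_rhs => rw [← Real.exp_log hb, ← Real.exp_add, Real.exp_log hb]
  congr 1
  ring

lemma rpow_mul_rpow_eq_zero {a b v : ℝ} (ha : 0 ≤ a) (hb : 0 ≤ b) (h : ¬(0 < a ∧ 0 < b))
    (h0 : 0 < v) (h1 : v < 1) : a ^ v * b ^ (1 - v) = 0 := by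
  rcases ha.eq_or_lt with rfl | ha
  · rw [Real.zero_rpow h0.ne', zero_mul]
  rcases hb.eq_or_lt with rfl | hb
  · rw [Real.zero_rpow (by linarith), mul_zero]
  exact absurd ⟨ha, hb⟩ h

lemma intervalIntegrable_rpow_mul_rpow {a b s : ℝ} (ha : 0 ≤ a) (hb : 0 ≤ b) (hs : 0 ≤ s)
    (hs' : s < 1 / 2) : IntervalIntegrable (fun v : ℝ => a ^ v * b ^ (1 - v))
      MeasureTheory.volume s (1 - s) := by
  by_cases h : 0 < a ∧ 0 < b
  · simp_rw [rpow_mul_rpow_eq_exp h.1 h.2]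
    exact Continuous.intervalIntegrable (by fun_prop) _ _
  · -- the open interval is needed: at `v = 0` or `v = 1` the convention `0 ^ 0 = 1` intervenes
    refine (intervalIntegrable_const (c := (0 : ℝ))).congr_uIoo fun v hv => ?_
    rw [Set.uIoo_of_le (by linarith)] at hv
    exact (rpow_mul_rpow_eq_zero ha hb h (hs.trans_lt hv.1) (by linarith [hv.2])).symm

lemma integral_rpow_mul_rpow {a b s : ℝ} (ha : 0 ≤ a) (hb : 0 ≤ b) (hs : 0 ≤ s)
    (hs' : s < 1 / 2) : ∫ v in s..(1 - s), a ^ v * b ^ (1 - v) =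
      heinzFactor ((1 - 2 * s) / 2) a b * (a ^ (1 - s) * b ^ s + a ^ s * b ^ (1 - s)) := by
  by_cases h : 0 < a ∧ 0 < b
  · rw [heinzFactor, if_pos h]
    have e := rpow_mul_rpow_eq_exp h.1 h.2 (1 - s)
    rw [sub_sub_cancel] at e
    rw [e]
    simp_rw [rpow_mul_rpow_eq_exp h.1 h.2]
    rw [← mul_sub]
    generalize Real.log a - Real.log b = L
    rw [intervalIntegral.integral_const_mul]
    by_cases hL : L = 0
    · simp [hL, tanhc]; ring
    set c := (1 - 2 * s) / 2 with hc
    have hc0 : 0 < c := by linarith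
    have hE := intervalIntegral.integral_comp_mul_left (a := s) (b := 1 - s) Real.exp hL
    rw [hE, integral_exp, tanhc, if_neg (by positivity), Real.tanh_eq]
    have e1 : Real.exp (L * (1 - s)) = Real.exp (L / 2) * Real.exp (c * L) := by
      rw [← Real.exp_add]; congr 1; rw [hc]; ring
    have e2 : Real.exp (L * s) = Real.exp (L / 2) * Real.exp (-(c * L)) := by
      rw [← Real.exp_add]; congr 1; rw [hc]; ring
    rw [e1, e2]
    have := Real.exp_pos (c * L)
    have := Real.exp_pos (-(c * L))
    rw [smul_eq_mul]
    field_simp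
  · rw [heinzFactor, if_neg h, zero_mul]
    rw [intervalIntegral.integral_congr_Ioo_of_le (g := fun _ => (0 : ℝ)) (by linarith)
      fun v hv => rpow_mul_rpow_eq_zero ha hb h (hs.trans_lt hv.1) (by linarith [hv.2])]
    simp

/-! ### Contractive Schur multipliers -/

section Multipliers

open Matrix Filter Topology

variable {n : Type*} {N : Seminorm ℂ (Matrix n n ℂ)}

/-- Entrywise multiplication by `M` does not increase `N`. -/
def IsSchurContraction (N : Seminorm ℂ (Matrix n n ℂ)) (M : Matrix n n ℂ) : Prop :=
  ∀ Y, N (M ⊙ Y) ≤ N Y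

namespace IsSchurContraction

lemma mul {M M' : Matrix n n ℂ} (h : IsSchurContraction N M) (h' : IsSchurContraction N M') :
    IsSchurContraction N (M ⊙ M') := fun Y => by
  rw [hadamard_assoc]
  exact (h _).trans (h' Y)

lemma one : IsSchurContraction N (Matrix.of fun _ _ => 1) := fun Y => by
  apply le_of_eq; congr 1; ext; simp

lemma convex {M M' : Matrix n n ℂ} (h : IsSchurContraction N M) (h' : IsSchurContraction N M')
    {t : ℝ} (h0 : 0 ≤ t) (h1 : t ≤ 1) :
    IsSchurContraction N ((t : ℂ) • M + ((1 - t : ℝ) : ℂ) • M') := fun Y => by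
  rw [add_hadamard, smul_hadamard, smul_hadamard]
  refine (map_add_le_add N _ _).trans ?_
  rw [map_smul_eq_mul, map_smul_eq_mul, Complex.norm_real, Complex.norm_real,
    Real.norm_of_nonneg h0, Real.norm_of_nonneg (by linarith)]
  nlinarith [h Y, h' Y]

end IsSchurContraction

variable [Fintype n] [DecidableEq n]

/-- Every seminorm on matrices is continuous for entrywise convergence. -/
lemma Seminorm.tendsto_matrix {ι : Type*} {l : Filter ι} {F : ι → Matrix n n ℂ}
    {G : Matrix n n ℂ} (N : Seminorm ℂ (Matrix n n ℂ))
    (h : ∀ i j, Tendsto (fun k => F k i j) l (𝓝 (G i j))) :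
    Tendsto (fun k => N (F k)) l (𝓝 (N G)) := by
  have bound : ∀ W : Matrix n n ℂ, N W ≤ ∑ i, ∑ j, ‖W i j‖ * N (Matrix.single i j 1) := by
    intro W
    conv_lhs => rw [Matrix.matrix_eq_sum_single W]
    refine (Finset.le_sum_of_subadditive N (map_zero N).le (map_add_le_add N) _ _).trans
      (Finset.sum_le_sum fun i _ => ?_)
    refine (Finset.le_sum_of_subadditive N (map_zero N).le (map_add_le_add N) _ _).trans
      (Finset.sum_le_sum fun j _ => ?_)
    rw [← map_smul_eq_mul, Matrix.smul_single, smul_eq_mul, mul_one]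
  have h0 : Tendsto (fun k => ∑ i, ∑ j, ‖(F k - G) i j‖ * N (Matrix.single i j 1)) l (𝓝 0) := by
    have : (0 : ℝ) = ∑ i : n, ∑ j : n, 0 * N (Matrix.single i j 1) := by simp
    rw [this]
    refine tendsto_finsetSum _ fun i _ => tendsto_finsetSum _ fun j _ => ?_
    exact (tendsto_iff_norm_sub_tendsto_zero.1 (h i j)).mul_const _
  rw [tendsto_iff_norm_sub_tendsto_zero]
  refine squeeze_zero (fun _ => norm_nonneg _) (fun k => ?_) h0
  exact (abs_sub_map_le_sub N _ _).trans (bound _)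

lemma IsSchurContraction.of_tendsto {ι : Type*} {l : Filter ι} [l.NeBot]
    {F : ι → Matrix n n ℂ} {M : Matrix n n ℂ}
    (hF : ∀ k, IsSchurContraction N (F k))
    (h : ∀ i j, Tendsto (fun k => F k i j) l (𝓝 (M i j))) : IsSchurContraction N M := fun Y =>
  le_of_tendsto (N.tendsto_matrix (F := fun k => F k ⊙ Y) fun i j => (h i j).mul_const (Y i j))
    (Eventually.of_forall fun k => hF k Y)

lemma diagonal_mem_unitaryGroup {u : n → ℂ} (hu : ∀ i, ‖u i‖ = 1) :
    diagonal u ∈ unitaryGroup n ℂ := by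
  rw [mem_unitaryGroup_iff, star_eq_conjTranspose, diagonal_conjTranspose, diagonal_mul_diagonal,
    ← diagonal_one]
  congr 1
  ext i
  simp [Complex.mul_conj, Complex.normSq_eq_norm_sq, hu i]

namespace IsUnitarilyInvariantNorm

lemma map_hadamard_unimodular (hN : IsUnitarilyInvariantNorm N) {u v : n → ℂ}
    (hu : ∀ i, ‖u i‖ = 1) (hv : ∀ j, ‖v j‖ = 1) (Y : Matrix n n ℂ) :
    N (Matrix.of (fun i j => u i * v j) ⊙ Y) = N Y := by
  rw [← hN.map_unitary_mul_mul _ (diagonal_mem_unitaryGroup hu) _ (diagonal_mem_unitaryGroup hv) Y]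
  congr 1
  ext i j
  simp [mul_right_comm]

/-- Multiplication by the indicator function of a rectangle is contractive: a diagonal projection
is the average of the identity and a diagonal unitary. -/
lemma isSchurContraction_indicator (hN : IsUnitarilyInvariantNorm N) (p q : n → Prop)
    [DecidablePred p] [DecidablePred q] :
    IsSchurContraction N (Matrix.of fun i j => if p i ∧ q j then (1 : ℂ) else 0) := by
  have hsign : ∀ (r : n → Prop) [DecidablePred r] (i : n), ‖(if r i then (1 : ℂ) else -1)‖ = 1 := by
    intro r _ i; split_ifs <;> simp
  have hp : IsSchurContraction N
      (Matrix.of fun i (_ : n) => (if p i then (1 : ℂ) else -1) * 1) := fun Y =>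
    (hN.map_hadamard_unimodular (v := fun _ => 1) (hsign p) (by simp) Y).le
  have hq : IsSchurContraction N
      (Matrix.of fun (_ : n) j => 1 * (if q j then (1 : ℂ) else -1)) := fun Y =>
    (hN.map_hadamard_unimodular (u := fun _ => 1) (by simp) (hsign q) Y).le
  -- each factor is `1 / 2 * 1 + 1 / 2 * (±1)`
  have h := (IsSchurContraction.one.convex hp (t := 1 / 2) (by norm_num) (by norm_num)).mul
    (IsSchurContraction.one.convex hq (t := 1 / 2) (by norm_num) (by norm_num))
  convert h using 1
  ext i j
  by_cases h1 : p i <;> by_cases h2 : q j <;> simp [h1, h2] <;> norm_num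

/-- Multiplication by `1 + i (x_i - y_j)` does not decrease `N`. It is `1 + G`, where
`G` generates the group `T_h` of isometries `Y ↦ (exp (i h (x_i - y_j)) Y_{ij})`; comparing
`(1 - h) Y + h (1 + G) Y = Y + h G Y` with `T_h Y` gives the bound as `h → 0`. -/
lemma le_map_hadamard_one_add (hN : IsUnitarilyInvariantNorm N) (x y : n → ℝ) (Y : Matrix n n ℂ) :
    N Y ≤ N (Matrix.of (fun i j => 1 + ((x i - y j : ℝ) : ℂ) * Complex.I) ⊙ Y) := by
  set d : n → n → ℂ := fun i j => ((x i - y j : ℝ) : ℂ) * Complex.I with hd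
  set Z := Matrix.of (fun i j => 1 + d i j) ⊙ Y with hZ
  -- the difference quotient of the isometry group minus its generator, applied to `Y`
  set R : ℝ → Matrix n n ℂ := fun h =>
    Matrix.of (fun i j => (h : ℂ)⁻¹ * (Complex.exp (h * d i j) - 1) - d i j) ⊙ Y with hR
  have key : ∀ᶠ h in 𝓝[>] (0 : ℝ), N Y ≤ N Z + N (R h) := by
    filter_upwards [self_mem_nhdsWithin, Ioo_mem_nhdsGT (one_pos : (0 : ℝ) < 1)] with h hpos hlt
    have hpos : 0 < h := hpos
    have hC : (h : ℂ) ≠ 0 := by exact_mod_cast hpos.ne'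
    have e : Matrix.of (fun i j => Complex.exp ((h * x i : ℝ) * Complex.I) *
        Complex.exp ((-(h * y j) : ℝ) * Complex.I)) ⊙ Y =
        ((1 - h : ℝ) : ℂ) • Y + ((h : ℂ) • Z + (h : ℂ) • R h) := by
      ext i j
      simp only [hadamard_apply, of_apply, Matrix.add_apply, Matrix.smul_apply, smul_eq_mul, hZ, hR]
      rw [← Complex.exp_add, ← add_mul]
      have : (((h * x i : ℝ) : ℂ) + ((-(h * y j) : ℝ) : ℂ)) * Complex.I = h * d i j := by
        simp only [hd]; push_cast; ring
      rw [this]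
      field_simp
      push_cast
      ring
    have h1 := hN.map_hadamard_unimodular
      (u := fun i => Complex.exp ((h * x i : ℝ) * Complex.I))
      (v := fun j => Complex.exp ((-(h * y j) : ℝ) * Complex.I))
      (fun i => Complex.norm_exp_ofReal_mul_I _) (fun j => Complex.norm_exp_ofReal_mul_I _) Y
    rw [e] at h1
    have h2 := map_add_le_add N (((1 - h : ℝ) : ℂ) • Y) ((h : ℂ) • Z + (h : ℂ) • R h)
    have h3 := map_add_le_add N ((h : ℂ) • Z) ((h : ℂ) • R h)
    simp only [map_smul_eq_mul, Complex.norm_real, Real.norm_of_nonneg hpos.le] at h2 h3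
    rw [Real.norm_of_nonneg (by linarith [hlt.2])] at h2
    have h4 : h * N Y ≤ h * (N Z + N (R h)) := by linarith
    exact le_of_mul_le_mul_left h4 hpos
  have hlim : Tendsto (fun h => N (R h)) (𝓝[>] (0 : ℝ)) (𝓝 0) := by
    suffices Tendsto (fun h => N (R h)) (𝓝[>] (0 : ℝ)) (𝓝 (N 0)) by rwa [map_zero] at this
    refine N.tendsto_matrix fun i j => ?_
    have hder : HasDerivAt (fun h : ℝ => Complex.exp (h * d i j)) (d i j) 0 := by
      have := ((Complex.ofRealCLM.hasDerivAt (x := (0 : ℝ))).mul_const (d i j)).cexp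
      simpa using this
    have hs := (hasDerivAt_iff_tendsto_slope_zero.1 hder).mono_left
      (nhdsWithin_mono 0 fun h (hh : h ∈ Set.Ioi 0) => (Set.mem_Ioi.1 hh).ne')
    have := (hs.sub_const (d i j)).mul_const (Y i j)
    simpa only [hR, hadamard_apply, of_apply, Matrix.zero_apply, Complex.real_smul,
      Complex.ofReal_inv, zero_add, Complex.ofReal_zero, zero_mul, Complex.exp_zero, sub_self] using this
  exact ge_of_tendsto (by simpa using hlim.const_add (N Z)) key

lemma isSchurContraction_inv_one_add (hN : IsUnitarilyInvariantNorm N) (x y : n → ℝ) :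
    IsSchurContraction N
      (Matrix.of fun i j => (1 + ((x i - y j : ℝ) : ℂ) * Complex.I)⁻¹) := fun Y => by
  refine (hN.le_map_hadamard_one_add x y _).trans_eq (congrArg N ?_)
  ext i j
  have : 1 + ((x i - y j : ℝ) : ℂ) * Complex.I ≠ 0 := fun h => by
    simpa using congrArg Complex.re h
  simp only [hadamard_apply, of_apply]
  rw [mul_inv_cancel_left₀ this]

lemma isSchurContraction_inv_one_add_sq (hN : IsUnitarilyInvariantNorm N) (x y : n → ℝ) :
    IsSchurContraction N (Matrix.of fun i j => (((1 + (x i - y j) ^ 2)⁻¹ : ℝ) : ℂ)) := by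
  -- `1 + t² = (1 + i t) (1 - i t)`
  convert (hN.isSchurContraction_inv_one_add x y).mul
    (hN.isSchurContraction_inv_one_add (fun i => -x i) fun j => -y j) using 1
  ext i j
  simp only [hadamard_apply, of_apply]
  rw [← mul_inv]
  push_cast
  congr 1
  linear_combination ((x i : ℂ) - y j) ^ 2 * Complex.I_sq

/-- For `α ≤ β` the function `(1 + t² / β²) / (1 + t² / α²)` is a convex combination of `1`
and of the contractive multiplier `1 / (1 + t² / α²)`. -/
lemma isSchurContraction_div (hN : IsUnitarilyInvariantNorm N) (x y : n → ℝ) {α β : ℝ}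
    (hα : 0 < α) (hαβ : α ≤ β) :
    IsSchurContraction N (Matrix.of fun i j =>
      (((1 + (x i - y j) ^ 2 / β ^ 2) / (1 + (x i - y j) ^ 2 / α ^ 2) : ℝ) : ℂ)) := by
  have hβ : 0 < β := hα.trans_le hαβ
  have h := IsSchurContraction.one.convex
    (hN.isSchurContraction_inv_one_add_sq (fun i => x i / α) fun j => y j / α)
    (t := α ^ 2 / β ^ 2) (by positivity)
    (div_le_one_of_le₀ (pow_le_pow_left₀ hα.le hαβ 2) (by positivity))
  convert h using 1
  ext i j
  simp only [of_apply, Matrix.add_apply, Matrix.smul_apply, smul_eq_mul, mul_one]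
  norm_cast
  rw [← sub_div]
  field_simp
  ring

lemma isSchurContraction_tanhc (hN : IsUnitarilyInvariantNorm N) (x y : n → ℝ) :
    IsSchurContraction N (Matrix.of fun i j => ((tanhc (x i - y j) : ℝ) : ℂ)) := by
  refine IsSchurContraction.of_tendsto (l := atTop) (F := fun m => Matrix.of fun i j =>
    ((∏ k ∈ Finset.range m, ((1 + (x i - y j) ^ 2 / ((k + 1) * Real.pi) ^ 2) /
      (1 + (2 * (x i - y j)) ^ 2 / ((2 * k + 1) * Real.pi) ^ 2)) : ℝ) : ℂ))
    (fun m => ?_) fun i j => ?_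
  · induction m with
    | zero => simpa using IsSchurContraction.one
    | succ m ih =>
      have hpi := Real.pi_pos
      convert ih.mul (hN.isSchurContraction_div x y (α := (2 * m + 1) * Real.pi / 2)
        (β := (m + 1) * Real.pi) (by positivity) (by nlinarith)) using 1
      ext i j
      simp only [hadamard_apply, of_apply]
      rw [Finset.prod_range_succ, Complex.ofReal_mul]
      congr 4
      field_simp
  · exact (Complex.continuous_ofReal.tendsto _).comp (tendsto_prod_tanhc (x i - y j))

lemma map_hadamard_heinzFactor_le (hN : IsUnitarilyInvariantNorm N) (a b : n → ℝ) {c : ℝ}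
    (hc : 0 ≤ c) (Y : Matrix n n ℂ) :
    N (Matrix.of (fun i j => ((heinzFactor c (a i) (b j) : ℝ) : ℂ)) ⊙ Y) ≤ c * N Y := by
  have h := ((hN.isSchurContraction_indicator (fun i => 0 < a i) fun j => 0 < b j).mul
    (hN.isSchurContraction_tanhc (fun i => c * Real.log (a i)) fun j => c * Real.log (b j))) Y
  refine le_trans (le_of_eq ?_) (mul_le_mul_of_nonneg_left h hc)
  have hnorm (Z : Matrix n n ℂ) : c * N Z = N ((c : ℂ) • Z) := by
    rw [map_smul_eq_mul, Complex.norm_real, Real.norm_of_nonneg hc]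
  rw [hnorm]
  congr 1
  ext i j
  by_cases hab : 0 < a i ∧ 0 < b j <;> simp [heinzFactor, hab, mul_assoc]

end IsUnitarilyInvariantNorm

end Multipliers

/-! ### Diagonalization -/

section Diagonalization

open Matrix

variable {n : Type*} [Fintype n]

lemma intervalIntegrable_finsetSum {ι : Type*} {s : Finset ι} {f : ι → ℝ → ℂ} {a b : ℝ}
    (h : ∀ i, IntervalIntegrable (f i) MeasureTheory.volume a b) :
    IntervalIntegrable (fun v => ∑ i ∈ s, f i v) MeasureTheory.volume a b := by
  simpa only [Finset.sum_fn] using IntervalIntegrable.sum s fun i _ => h i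

lemma mul_mul_apply_eq_sum (P F Q : Matrix n n ℂ) (p q : n) :
    (P * F * Q) p q = ∑ j, ∑ i, P p i * F i j * Q j q := by
  simp [Matrix.mul_apply, Finset.sum_mul]

lemma MatrixIntegrable.mul_mul {F : ℝ → Matrix n n ℂ} {a b : ℝ} (h : MatrixIntegrable F a b)
    (P Q : Matrix n n ℂ) : MatrixIntegrable (fun v => P * F v * Q) a b := fun p q => by
  simp_rw [mul_mul_apply_eq_sum]
  refine intervalIntegrable_finsetSum fun j => intervalIntegrable_finsetSum fun i => ?_
  exact ((h i j).const_mul _).mul_const _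

lemma MatrixIntegrable.integral_mul_mul {F : ℝ → Matrix n n ℂ} {a b : ℝ}
    (h : MatrixIntegrable F a b) (P Q : Matrix n n ℂ) :
    matrixIntegral (fun v => P * F v * Q) a b = P * matrixIntegral F a b * Q := by
  ext p q
  have hi : ∀ i j, IntervalIntegrable (fun v => P p i * F v i j * Q j q)
      MeasureTheory.volume a b := fun i j => ((h i j).const_mul _).mul_const _
  rw [mul_mul_apply_eq_sum]
  simp only [matrixIntegral, of_apply, mul_mul_apply_eq_sum]
  rw [intervalIntegral.integral_finsetSum fun j _ =>
    intervalIntegrable_finsetSum fun i => hi i j]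
  refine Finset.sum_congr rfl fun j _ => ?_
  rw [intervalIntegral.integral_finsetSum fun i _ => hi i j]
  refine Finset.sum_congr rfl fun i _ => ?_
  rw [intervalIntegral.integral_mul_const, intervalIntegral.integral_const_mul]

variable [DecidableEq n]

lemma Matrix.PosSemidef.rpow_eq {A : Matrix n n ℂ} (hA : A.PosSemidef) (v : ℝ) :
    A ^ v = (hA.isHermitian.eigenvectorUnitary : Matrix n n ℂ) *
      diagonal (fun i => ((hA.isHermitian.eigenvalues i ^ v : ℝ) : ℂ)) *
      star (hA.isHermitian.eigenvectorUnitary : Matrix n n ℂ) := by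
  rw [CFC.rpow_eq_cfc_real hA.nonneg, hA.isHermitian.cfc_eq, IsHermitian.cfc,
    Unitary.conjStarAlgAut_apply]
  rfl

/-- In eigenbases of `A` and `B`, the matrix `A ^ v * X * B ^ w` is an entrywise multiple of a
fixed matrix. -/
lemma Matrix.PosSemidef.rpow_mul_mul_rpow_eq {A B : Matrix n n ℂ} (hA : A.PosSemidef)
    (hB : B.PosSemidef) (X : Matrix n n ℂ) (v w : ℝ) :
    A ^ v * X * B ^ w = (hA.isHermitian.eigenvectorUnitary : Matrix n n ℂ) *
      (Matrix.of (fun i j => ((hA.isHermitian.eigenvalues i ^ v *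
          hB.isHermitian.eigenvalues j ^ w : ℝ) : ℂ)) ⊙
        (star (hA.isHermitian.eigenvectorUnitary : Matrix n n ℂ) * X *
          (hB.isHermitian.eigenvectorUnitary : Matrix n n ℂ))) *
      star (hB.isHermitian.eigenvectorUnitary : Matrix n n ℂ) := by
  have e : ∀ (p q : n → ℝ) (Y : Matrix n n ℂ),
      Matrix.of (fun i j => ((p i * q j : ℝ) : ℂ)) ⊙ Y =
        diagonal (fun i => (p i : ℂ)) * Y * diagonal (fun i => (q i : ℂ)) := by
    intro p q Y
    ext i j
    simp [mul_right_comm]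
  rw [hA.rpow_eq, hB.rpow_eq, e]
  simp only [Matrix.mul_assoc]

end Diagonalization

/-- The powers `A ^ v`, `v : ℝ`, are those of the continuous functional calculus, so that
`A ^ (0 : ℝ) = 1` also when `A` is singular. -/
theorem theorem2p4 {n : Type*} [Fintype n] [DecidableEq n]
    (N : Seminorm ℂ (Matrix n n ℂ)) (hN : IsUnitarilyInvariantNorm N)
    (A B X : Matrix n n ℂ) (hA : A.PosSemidef) (hB : B.PosSemidef) :
    (∀ s : ℝ, 0 ≤ s → s < 1 / 2 →
      MatrixIntegrable (fun v : ℝ => A ^ v * X * B ^ (1 - v)) s (1 - s) ∧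
      N (matrixIntegral (fun v : ℝ => A ^ v * X * B ^ (1 - v)) s (1 - s)) ≤
        (1 - 2 * s) / 2 * N (A ^ (1 - s) * X * B ^ s + A ^ s * X * B ^ (1 - s))) ∧
    N (matrixIntegral (fun v : ℝ => A ^ v * X * B ^ (1 - v)) 0 1) ≤
      1 / 2 * N (A * X + X * B) := by
  have main : ∀ s : ℝ, 0 ≤ s → s < 1 / 2 →
      MatrixIntegrable (fun v : ℝ => A ^ v * X * B ^ (1 - v)) s (1 - s) ∧
      N (matrixIntegral (fun v : ℝ => A ^ v * X * B ^ (1 - v)) s (1 - s)) ≤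
        (1 - 2 * s) / 2 * N (A ^ (1 - s) * X * B ^ s + A ^ s * X * B ^ (1 - s)) := by
    intro s hs hs'
    simp_rw [hA.rpow_mul_mul_rpow_eq hB X]
    have ha := hA.eigenvalues_nonneg
    have hb := hB.eigenvalues_nonneg
    set a := hA.isHermitian.eigenvalues
    set b := hB.isHermitian.eigenvalues
    have hU := hA.isHermitian.eigenvectorUnitary.2
    have hV := Unitary.star_mem hB.isHermitian.eigenvectorUnitary.2
    set U : Matrix n n ℂ := hA.isHermitian.eigenvectorUnitary.1
    set V : Matrix n n ℂ := hB.isHermitian.eigenvectorUnitary.1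
    set Y : Matrix n n ℂ := star U * X * V
    have hint : MatrixIntegrable (fun v : ℝ => Matrix.hadamard
        (Matrix.of fun i j => ((a i ^ v * b j ^ (1 - v) : ℝ) : ℂ)) Y) s (1 - s) := fun i j =>
      have h := intervalIntegrable_rpow_mul_rpow (ha i) (hb j) hs hs'
      IntervalIntegrable.mul_const ⟨h.1.ofReal, h.2.ofReal⟩ (Y i j)
    refine ⟨hint.mul_mul U (star V), ?_⟩
    rw [hint.integral_mul_mul, ← Matrix.add_mul, ← Matrix.mul_add, hN.map_unitary_mul_mul _ hU _ hV,
      hN.map_unitary_mul_mul _ hU _ hV, ← Matrix.add_hadamard]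
    refine le_trans (le_of_eq ?_)
      (hN.map_hadamard_heinzFactor_le a b (c := (1 - 2 * s) / 2) (by linarith) _)
    congr 1
    ext i j
    simp only [matrixIntegral, Matrix.of_apply, Matrix.hadamard_apply, Matrix.add_apply]
    rw [intervalIntegral.integral_mul_const, intervalIntegral.integral_ofReal,
      integral_rpow_mul_rpow (ha i) (hb j) hs hs']
    push_cast
    ring
  refine ⟨main, ?_⟩
  have h := (main 0 le_rfl (by norm_num)).2
  simpa [CFC.rpow_one A hA.nonneg, CFC.rpow_one B hB.nonneg, CFC.rpow_zero A hA.nonneg,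
    CFC.rpow_zero B hB.nonneg] using h
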